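/- Let $m>1$ and $n\ge 1$ be integers. A linear cellular automaton (LCA) over $(\mathbb{Z}/m\mathbb{Z})^n$ is a map $\mathcal F$ on $((\mathbb{Z}/m\mathbb{Z})^n)^{\mathbb{Z}}$ of the form $\mathcal F(c)_i=\sum_{z=-r}^{r}A_z\,c_{i+z}$ with $r\in\mathbb{N}$ and $A_{-r},\dots,A_r\in(\mathbb{Z}/m\mathbb{Z})^{n\times n}$; the matrix associated with $\mathcal F$ is $A=\sum_{z=-r}^{r}A_zX^{-z}$, an $n\times n$ matrix over the Laurent polynomial ring $(\mathbb{Z}/m\mathbb{Z})[X,X^{-1}]$. Let $d$ be the Tychonoff distance $d(c,c')=2^{-\min\{|j|\,:\,c_j\neq c'_j\}}$ for $c\ne c'$, and $d(c,c)=0$. The LCA $\mathcal F$ is positively expansive if there is $\varepsilon>0$ such that for all configurations $c\neq c'$ there is a natural number $\ell\ge 0$ with $d(\mathcal F^{\ell}(c),\mathcal F^{\ell}(c'))\ge\varepsilon$. For a nonzero Laurent polynomial $\alpha$ let $\deg^+(\alpha)$ and $\deg^-(\alpha)$ be the maximum and the minimum degree of its monomials, and put $\deg^+(0)=-\infty$,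 $\deg^-(0)=+\infty$. A square matrix over a Laurent polynomial ring is expansive if its characteristic polynomial $\alpha_0+\alpha_1t+\dots+\alpha_{n-1}t^{n-1}+t^n$ satisfies $\alpha_0\ne0$, $\deg^+(\alpha_0)>0$, $\deg^-(\alpha_0)<0$, and $\deg^+(\alpha_0)>\deg^+(\alpha_i)$ and $\deg^-(\alpha_0)<\deg^-(\alpha_i)$ for every $i\in\{1,\dots,n-1\}$. Then: (1) For all $m>1$ and $n\ge1$, an LCA over $(\mathbb{Z}/m\mathbb{Z})^n$ with associated matrix $A$ is positively expansive if and only if, for every prime $p$ dividing $m$, the matrix $A \bmod p$ over $(\mathbb{Z}/p\mathbb{Z})[X,X^{-1}]$, obtained by reducing all coefficients modulo $p$, is expansive. (2) Positive expansivity is decidable for LCA over $(\mathbb{Z}/m\mathbb{Z})^n$, uniformly in $m$ and $n$: there is an algorithm (a total computable function) which, given $m>1$, $n\ge1$, $r\in\mathbb{N}$ and the matrices $A_{-r},\dots,A_r\in(\mathbb{Z}/m\mathbb{Z})^{n\times n}$, decides whether the LCA they define is positively expansive. -/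

import Mathlib

noncomputable section

namespace LinearCA

/-- The standard Tychonoff distance on configurations: `d(c, c') = 2 ^ (-k)`, where `k` is the
least `|j|` with `c j ≠ c' j`, and `d(c, c) = 0`. -/
def tychonoffDist {S : Type*} (c c' : ℤ → S) : ℝ :=
  open Classical in
  if c = c' then 0 else (2 : ℝ)⁻¹ ^ sInf {k : ℕ | ∃ j : ℤ, j.natAbs = k ∧ c j ≠ c' j}

/-- The global rule of the one-dimensional cellular automaton with radius `r` and local rule `f`.
The argument `k : Fin (2 * r + 1)` of the local rule stands for the offset `k - r ∈ [-r, r]`. -/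
def globalRule {S : Type*} (r : ℕ) (f : (Fin (2 * r + 1) → S) → S) (c : ℤ → S) : ℤ → S :=
  fun i => f fun k => c (i + ((k : ℤ) - (r : ℤ)))

/-- Positive expansivity of a transformation of a configuration space. -/
def PositivelyExpansive {S : Type*} (F : (ℤ → S) → (ℤ → S)) : Prop :=
  ∃ ε : ℝ, 0 < ε ∧ ∀ c c' : ℤ → S, c ≠ c' → ∃ l : ℕ, ε ≤ tychonoffDist (F^[l] c) (F^[l] c')

/-- A linear local rule over `(ℤ/mℤ)^n`: a radius `r` and matrices `A_{-r}, …, A_r`.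
The matrix `A_z` is `mat k` for the index `k = z + r`. -/
structure LinearRule (m n : ℕ) where
  radius : ℕ
  mat : Fin (2 * radius + 1) → Matrix (Fin n) (Fin n) (ZMod m)

namespace LinearRule

variable {m n : ℕ}

/-- The local rule `(x_{-r}, …, x_r) ↦ ∑_z A_z x_z`. -/
def localRule (A : LinearRule m n) (x : Fin (2 * A.radius + 1) → (Fin n → ZMod m)) :
    Fin n → ZMod m :=
  ∑ k, (A.mat k).mulVec (x k)

/-- The linear cellular automaton (its global rule) defined by a linear local rule. -/
def automaton (A : LinearRule m n) : (ℤ → (Fin n → ZMod m)) → (ℤ → (Fin n → ZMod m)) :=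
  globalRule A.radius A.localRule

/-- The matrix `∑_{z = -r}^{r} A_z X^{-z}` of Laurent polynomials associated with a linear
cellular automaton. -/
def assocMatrix (A : LinearRule m n) : Matrix (Fin n) (Fin n) (LaurentPolynomial (ZMod m)) :=
  Matrix.of fun i j => ∑ k : Fin (2 * A.radius + 1),
    LaurentPolynomial.C (A.mat k i j) * LaurentPolynomial.T (-((k : ℤ) - (A.radius : ℤ)))

/-- The finite description `(m, n, r, [A_{-r}, …, A_r])` of a linear cellular automaton: each
matrix is the list of its rows, a row is the list of its entries, and an entry of `ℤ/mℤ` is given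
by its representative in `{0, …, m - 1}`. -/
def code (A : LinearRule m n) : ℕ × ℕ × ℕ × List (List (List ℕ)) :=
  (m, n, A.radius, List.ofFn fun k => List.ofFn fun i => List.ofFn fun j => (A.mat k i j).val)

end LinearRule

/-- The positive degree: the maximal degree of a monomial, and `-∞` for `0`. -/
def posDeg {R : Type*} [Semiring R] (a : LaurentPolynomial R) : WithBot ℤ :=
  a.coeff.support.max

/-- The negative degree: the minimal degree of a monomial, and `+∞` for `0`. -/
def negDeg {R : Type*} [Semiring R] (a : LaurentPolynomial R) : WithTop ℤ :=
  a.coeff.support.min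

/-- Expansivity of a monic polynomial `α₀ + α₁ t + ⋯ + α_{n-1} t^{n-1} + t^n` over the Laurent
polynomials. -/
def ExpansivePoly {R : Type*} [Semiring R] (π : Polynomial (LaurentPolynomial R)) : Prop :=
  π.coeff 0 ≠ 0 ∧
  (0 < posDeg (π.coeff 0) ∧
    ∀ i : ℕ, 1 ≤ i → i < π.natDegree → posDeg (π.coeff i) < posDeg (π.coeff 0)) ∧
  (negDeg (π.coeff 0) < 0 ∧
    ∀ i : ℕ, 1 ≤ i → i < π.natDegree → negDeg (π.coeff 0) < negDeg (π.coeff i))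

/-- A matrix of Laurent polynomials is expansive if its characteristic polynomial is. -/
def ExpansiveMatrix {R : Type*} [CommRing R] {n : ℕ}
    (A : Matrix (Fin n) (Fin n) (LaurentPolynomial R)) : Prop :=
  ExpansivePoly A.charpoly

/-- Reduction modulo a divisor `q` of `m` of all coefficients of a matrix of Laurent polynomials
over `ℤ/mℤ`. -/
def reduceMod {m n q : ℕ} (h : q ∣ m)
    (A : Matrix (Fin n) (Fin n) (LaurentPolynomial (ZMod m))) :
    Matrix (Fin n) (Fin n) (LaurentPolynomial (ZMod q)) :=
  A.map (AddMonoidAlgebra.mapRingHom ℤ (ZMod.castHom h (ZMod q)))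

end LinearCA

end

/-! Call a configuration invisible at `N` if its whole orbit vanishes on `[-N, N]`. By linearity,
positive expansivity says that for some `N` only 0 is invisible. Multiplication by `m / p` embeds
the configurations over `ℤ/p` into those over `ℤ/m`, and every nonzero configuration has a nonzero
multiple in one of these images, so the primes dividing `m` can be treated separately
(`positivelyExpansive_iff_forall_prime`).

Modulo a prime, sufficiency is Cayley–Hamilton. In the recurrence given by the characteristic
polynomial, an extreme monomial of `α₀` reads a cell beyond all the others, so that cell is
determined by times `0, …, n` in a window of radius `n * r` (`windowGrows_of_expansiveMatrix`). By
translation the visible region then grows to the whole line.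

Necessity is a duality argument. Configurations are the linear functionals on Laurent row vectors,
and the automaton is adjoint to right multiplication by `A`; so if nothing but 0 is invisible, the
vectors `T^j e_k A^l` with `|j| ≤ N` span (`span_visible_eq_top`). Take a valuation on an algebraic
closure with `v (T^ε) > 1`, `ε = ±1`. An eigenvector whose eigenvalue `x` has `v x ≤ 1` would define
a functional bounded on this span but unbounded on powers of `T`. Hence all eigenvalues have
valuation above 1 (`one_lt_valuation_of_root`), so the constant coefficient of the characteristic
polynomial strictly dominates the others, and valuations convert back into degrees.

For decidability, expansivity modulo `p` is equivalent to `WindowGrows (n * r) n`. Its bounds are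
explicit, so it is a statement about finitely many finite space-time arrays, and checking it is
primitive recursive. -/

namespace LinearCA

/-! ### Positive expansivity as injectivity of observation through a finite window -/

section Dynamics

theorem two_inv_pow_le_tychonoffDist_iff {S : Type*} (N : ℕ) (c c' : ℤ → S) :
    (2 : ℝ)⁻¹ ^ N ≤ tychonoffDist c c' ↔ ∃ j : ℤ, j.natAbs ≤ N ∧ c j ≠ c' j := by
  unfold tychonoffDist
  split_ifs with h
  · subst h
    simp
  · have hne : {k : ℕ | ∃ j : ℤ, j.natAbs = k ∧ c j ≠ c' j}.Nonempty := by
      obtain ⟨j, hj⟩ := Function.ne_iff.1 h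
      exact ⟨_, j, rfl, hj⟩
    rw [pow_le_pow_iff_right_of_lt_one₀ (by norm_num) (by norm_num)]
    constructor
    · intro hN
      obtain ⟨j, hj, hcj⟩ := Nat.sInf_mem hne
      exact ⟨j, hj.trans_le hN, hcj⟩
    · rintro ⟨j, hj, hcj⟩
      have hmem : j.natAbs ∈ {k : ℕ | ∃ j : ℤ, j.natAbs = k ∧ c j ≠ c' j} := ⟨j, rfl, hcj⟩
      exact (Nat.sInf_le hmem).trans hj

theorem positivelyExpansive_iff_exists_window {S : Type*} (F : (ℤ → S) → (ℤ → S)) :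
    PositivelyExpansive F ↔ ∃ N : ℕ, ∀ c c' : ℤ → S,
      (∀ (l : ℕ) (j : ℤ), j.natAbs ≤ N → F^[l] c j = F^[l] c' j) → c = c' := by
  constructor
  · rintro ⟨ε, hε, h⟩
    obtain ⟨N, hN⟩ := exists_pow_lt_of_lt_one hε (show (2 : ℝ)⁻¹ < 1 by norm_num)
    refine ⟨N, fun c c' hc => ?_⟩
    by_contra hne
    obtain ⟨l, hl⟩ := h c c' hne
    obtain ⟨j, hj, hcj⟩ := (two_inv_pow_le_tychonoffDist_iff N _ _).1 (hN.le.trans hl)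
    exact hcj (hc l j hj)
  · rintro ⟨N, hN⟩
    refine ⟨(2 : ℝ)⁻¹ ^ N, by positivity, fun c c' hne => ?_⟩
    by_contra! hlt
    refine hne (hN c c' fun l j hj => ?_)
    by_contra hcj
    exact (hlt l).not_ge ((two_inv_pow_le_tychonoffDist_iff N _ _).2 ⟨j, hj, hcj⟩)

end Dynamics

/-! ### Invisible configurations and growing windows -/

namespace LinearRule

variable {m n : ℕ} (A : LinearRule m n)

theorem automaton_apply (c : ℤ → Fin n → ZMod m) (i : ℤ) :
    A.automaton c i = ∑ k : Fin (2 * A.radius + 1),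
      (A.mat k).mulVec (c (i + ((k : ℤ) - (A.radius : ℤ)))) := rfl

/-- The linear cellular automaton as a linear map. -/
noncomputable def automatonHom : Module.End (ZMod m) (ℤ → Fin n → ZMod m) where
  toFun := A.automaton
  map_add' c c' := by
    funext i
    simp [automaton_apply, Matrix.mulVec_add, Finset.sum_add_distrib]
  map_smul' a c := by
    funext i
    simp [automaton_apply, Matrix.mulVec_smul, Finset.smul_sum]

theorem automaton_iterate (l : ℕ) (c : ℤ → Fin n → ZMod m) :
    A.automaton^[l] c = (A.automatonHom ^ l) c := by
  rw [Module.End.pow_apply]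
  rfl

theorem automatonHom_apply (c : ℤ → Fin n → ZMod m) : A.automatonHom c = A.automaton c := rfl

/-- The configurations whose orbit vanishes on `[-N, N]`. -/
noncomputable def invisible (N : ℕ) : Submodule (ZMod m) (ℤ → Fin n → ZMod m) where
  carrier := {c | ∀ (l : ℕ) (j : ℤ), j.natAbs ≤ N → (A.automatonHom ^ l) c j = 0}
  add_mem' hc hc' l j hj := by simp [hc l j hj, hc' l j hj]
  zero_mem' l j _ := by simp
  smul_mem' a c hc l j hj := by simp [hc l j hj]

theorem invisible_antitone : Antitone A.invisible := fun _ _ h _ hc l j hj =>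
  hc l j (hj.trans h)

theorem positivelyExpansive_iff :
    PositivelyExpansive A.automaton ↔ ∃ N, A.invisible N = ⊥ := by
  rw [positivelyExpansive_iff_exists_window]
  refine exists_congr fun N => ⟨fun h => ?_, fun h c c' hc => ?_⟩
  · refine (Submodule.eq_bot_iff _).2 fun c hc => h c 0 fun l j hj => ?_
    rw [automaton_iterate, automaton_iterate, hc l j hj]
    simp
  · rw [← sub_eq_zero]
    refine (Submodule.eq_bot_iff _).1 h _ fun l j hj => ?_
    have := hc l j hj
    rw [automaton_iterate, automaton_iterate] at this
    simp [this]

/-- Translation of configurations. -/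
def shift (s : ℤ) (c : ℤ → Fin n → ZMod m) : ℤ → Fin n → ZMod m := fun i => c (i + s)

theorem automatonHom_pow_shift (s : ℤ) (c : ℤ → Fin n → ZMod m) (l : ℕ) :
    (A.automatonHom ^ l) (shift s c) = shift s ((A.automatonHom ^ l) c) := by
  induction l with
  | zero => rfl
  | succ l ih =>
    rw [pow_succ', Module.End.mul_apply, ih, Module.End.mul_apply]
    funext i
    simp only [automatonHom_apply, automaton_apply, shift]
    refine Finset.sum_congr rfl fun k _ => ?_
    rw [add_right_comm]

/-- The values at `±(N + 1)` are determined by the first `L + 1` steps seen through `[-N, N]`. -/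
def WindowGrows (N L : ℕ) : Prop :=
  ∀ c : ℤ → Fin n → ZMod m, (∀ l ≤ L, ∀ j : ℤ, j.natAbs ≤ N → (A.automatonHom ^ l) c j = 0) →
    c (N + 1) = 0 ∧ c (-(N + 1)) = 0

variable {A}

theorem WindowGrows.invisible_le_succ {N L : ℕ} (h : A.WindowGrows N L) :
    A.invisible N ≤ A.invisible (N + 1) := by
  intro c hc l j hj
  have key : ∀ l, (A.automatonHom ^ l) c (N + 1) = 0 ∧ (A.automatonHom ^ l) c (-(N + 1)) = 0 :=
    fun l => h _ fun l' _ j hj => by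
      rw [← Module.End.mul_apply, ← pow_add]
      exact hc _ j hj
  rcases Nat.lt_or_ge N j.natAbs with hlt | hle
  · have : j = N + 1 ∨ j = -(N + 1) := by omega
    rcases this with rfl | rfl
    exacts [(key l).1, (key l).2]
  · exact hc l j hle

theorem shift_mem_invisible {N : ℕ} {c : ℤ → Fin n → ZMod m} {s : ℤ} {k : ℕ} (hs : s.natAbs ≤ k)
    (hc : c ∈ A.invisible (N + k)) : shift s c ∈ A.invisible N := by
  intro l j hj
  rw [automatonHom_pow_shift]
  exact hc l _ (by omega)

/-- The automaton commutes with translations, so every translate of the window inside `[-(N + k), N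
+ k]` grows by one cell on each side; together the enlarged translates cover the next interval. -/
theorem WindowGrows.invisible_le_add {N L : ℕ} (h : A.WindowGrows N L) (k : ℕ) :
    A.invisible N ≤ A.invisible (N + k) := by
  induction k with
  | zero => exact le_rfl
  | succ k ih =>
    intro c hc l j hj
    have hsh : ∀ s : ℤ, s.natAbs ≤ k → shift s c ∈ A.invisible (N + 1) := fun s hs =>
      h.invisible_le_succ (shift_mem_invisible hs (ih hc))
    obtain ⟨s, hs, hjs⟩ : ∃ s : ℤ, s.natAbs ≤ k ∧ (j - s).natAbs ≤ N + 1 := by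
      by_cases h0 : 0 ≤ j
      · exact ⟨min j k, by omega, by omega⟩
      · exact ⟨max j (-k), by omega, by omega⟩
    have := hsh s hs l (j - s) hjs
    rw [automatonHom_pow_shift] at this
    simpa [shift] using this

theorem WindowGrows.positivelyExpansive {N L : ℕ} (h : A.WindowGrows N L) :
    PositivelyExpansive A.automaton := by
  refine A.positivelyExpansive_iff.2 ⟨N, (Submodule.eq_bot_iff _).2 fun c hc => ?_⟩
  funext j
  exact h.invisible_le_add j.natAbs hc 0 j (by omega)

variable (A)

/-- Reduction of a linear rule modulo a divisor. -/
def reduce {q : ℕ} (h : q ∣ m) : LinearRule q n where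
  radius := A.radius
  mat k := (A.mat k).map (ZMod.castHom h (ZMod q))

theorem automatonHom_pow_reduce {q : ℕ} (h : q ∣ m) (c : ℤ → Fin n → ZMod m) (l : ℕ) :
    ((A.reduce h).automatonHom ^ l) (fun j i => ZMod.castHom h (ZMod q) (c j i)) =
      fun j i => ZMod.castHom h (ZMod q) ((A.automatonHom ^ l) c j i) := by
  induction l with
  | zero => rfl
  | succ l ih =>
    rw [pow_succ', Module.End.mul_apply, ih, pow_succ', Module.End.mul_apply]
    funext j i
    simp only [automatonHom_apply, automaton_apply, Finset.sum_apply, Matrix.mulVec, dotProduct,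
      map_sum, map_mul]
    rfl

end LinearRule

/-! ### Reduction to the prime divisors of the modulus -/

theorem natCast_div_mul_eq_zero_iff {m p : ℕ} [NeZero m] (h : p ∣ m) (y : ZMod m) :
    ((m / p : ℕ) : ZMod m) * y = 0 ↔ ZMod.castHom h (ZMod p) y = 0 := by
  obtain ⟨k, rfl⟩ := h
  have hm := NeZero.ne (p * k)
  have hp : 0 < p := Nat.pos_of_ne_zero (by rintro rfl; simp at hm)
  have hk : 0 < k := Nat.pos_of_ne_zero (by rintro rfl; simp at hm)
  obtain ⟨a, rfl⟩ := ZMod.natCast_zmod_surjective y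
  rw [Nat.mul_div_cancel_left _ hp, ← Nat.cast_mul, ZMod.natCast_eq_zero_iff, map_natCast,
    ZMod.natCast_eq_zero_iff, mul_comm p k]
  exact Nat.mul_dvd_mul_iff_left hk

theorem exists_eq_natCast_div_mul {m p : ℕ} [NeZero m] (h : p ∣ m) (y : ZMod m)
    (hy : (p : ZMod m) * y = 0) : ∃ z : ZMod m, y = ((m / p : ℕ) : ZMod m) * z := by
  obtain ⟨k, rfl⟩ := h
  have hm := NeZero.ne (p * k)
  have hp : 0 < p := Nat.pos_of_ne_zero (by rintro rfl; simp at hm)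
  obtain ⟨a, rfl⟩ := ZMod.natCast_zmod_surjective y
  rw [← Nat.cast_mul, ZMod.natCast_eq_zero_iff] at hy
  obtain ⟨b, rfl⟩ := (Nat.mul_dvd_mul_iff_left hp).1 hy
  exact ⟨b, by rw [Nat.mul_div_cancel_left _ hp, Nat.cast_mul]⟩

namespace LinearRule

variable {m n : ℕ} (A : LinearRule m n)

theorem invisible_reduce_eq_bot [NeZero m] {p N : ℕ} (h : p ∣ m) (hA : A.invisible N = ⊥) :
    (A.reduce h).invisible N = ⊥ := by
  refine (Submodule.eq_bot_iff _).2 fun c hc => ?_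
  choose g hg using ZMod.castHom_surjective (n := m) h
  have hcg : c = fun j i => ZMod.castHom h (ZMod p) (g (c j i)) := by simp only [hg]
  -- The lift `g` need not be additive: multiplication by `m / p` only sees residues modulo `p`.
  have hmem : ((m / p : ℕ) : ZMod m) • (fun j i => g (c j i)) ∈ A.invisible N := by
    intro l j hj
    funext i
    have := hc l j hj
    rw [hcg, automatonHom_pow_reduce] at this
    rw [map_smul]
    exact (natCast_div_mul_eq_zero_iff h _).2 (congrFun this i)
  have h0 := (Submodule.eq_bot_iff _).1 hA _ hmem
  rw [hcg]
  funext j i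
  exact (natCast_div_mul_eq_zero_iff h _).1 (congrFun (congrFun h0 j) i)

theorem invisible_eq_bot_of_reduce [NeZero m] {N : ℕ}
    (hA : ∀ (p : ℕ) (_ : p.Prime) (h : p ∣ m), (A.reduce h).invisible N = ⊥) :
    A.invisible N = ⊥ := by
  refine (Submodule.eq_bot_iff _).2 fun c hc => ?_
  by_contra hne
  have hmc : m • c = 0 := by
    funext j i
    simp
  have hdvd : addOrderOf c ∣ m := addOrderOf_dvd_of_nsmul_eq_zero hmc
  have hpos : 0 < addOrderOf c := Nat.pos_of_dvd_of_pos hdvd (Nat.pos_of_ne_zero (NeZero.ne m))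
  have h1 : addOrderOf c ≠ 1 := fun h => hne (AddMonoid.addOrderOf_eq_one_iff.1 h)
  -- With `k = addOrderOf c / p`, the multiple `k • c` is nonzero and killed by `p`, hence `m / p`
  -- times some configuration `z`, whose reduction modulo `p` is invisible.
  obtain ⟨p, hp, k, hk⟩ := Nat.exists_prime_and_dvd h1
  have hpm : p ∣ m := (Dvd.intro _ hk.symm).trans hdvd
  have hk0 : 0 < k := Nat.pos_of_ne_zero (by rintro rfl; simp [hk] at hpos)
  have hkc : k • c ≠ 0 := nsmul_ne_zero_of_lt_addOrderOf hk0.ne' (by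
    rw [hk]; exact lt_mul_of_one_lt_left hk0 hp.one_lt)
  have hpk : p • k • c = 0 := by rw [← mul_nsmul', ← hk, addOrderOf_nsmul_eq_zero]
  have hz : ∀ j i, ∃ z : ZMod m, (k • c) j i = ((m / p : ℕ) : ZMod m) * z := fun j i =>
    exists_eq_natCast_div_mul hpm _ (by simpa using congrFun (congrFun hpk j) i)
  choose z hz using hz
  have hkz : k • c = ((m / p : ℕ) : ZMod m) • z := by
    funext j i
    exact hz j i
  have hmem : (fun j i => ZMod.castHom hpm (ZMod p) (z j i)) ∈ (A.reduce hpm).invisible N := by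
    intro l j hj
    rw [automatonHom_pow_reduce]
    funext i
    refine (natCast_div_mul_eq_zero_iff hpm _).1 ?_
    have := (A.invisible N).nsmul_mem hc k l j hj
    rw [hkz, map_smul] at this
    exact congrFun this i
  have h0 := (Submodule.eq_bot_iff _).1 (hA p hp hpm) _ hmem
  refine hkc ?_
  funext j i
  rw [hz j i]
  exact (natCast_div_mul_eq_zero_iff hpm _).2 (congrFun (congrFun h0 j) i)

theorem positivelyExpansive_iff_forall_prime (hm : m ≠ 0) :
    PositivelyExpansive A.automaton ↔
      ∀ (p : ℕ) (_ : p.Prime) (h : p ∣ m), PositivelyExpansive (A.reduce h).automaton := by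
  have : NeZero m := ⟨hm⟩
  simp only [positivelyExpansive_iff]
  refine ⟨fun ⟨N, hN⟩ p _ h => ⟨N, A.invisible_reduce_eq_bot h hN⟩, fun H => ?_⟩
  choose f hf using H
  -- Only finitely many primes divide `m`, so the largest of their windows serves all of them.
  refine ⟨m.primeFactors.attach.sup fun p =>
    f p.1 (Nat.prime_of_mem_primeFactors p.2) (Nat.dvd_of_mem_primeFactors p.2), ?_⟩
  refine A.invisible_eq_bot_of_reduce fun p hp h => ?_
  rw [← le_bot_iff, ← hf p hp h]
  exact invisible_antitone _ (Finset.le_sup (f := fun p : m.primeFactors =>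
    f p.1 (Nat.prime_of_mem_primeFactors p.2) (Nat.dvd_of_mem_primeFactors p.2))
    (Finset.mem_attach _ ⟨p, Nat.mem_primeFactors.2 ⟨hp, h, hm⟩⟩))

end LinearRule

end LinearCA

namespace LinearCA

open LaurentPolynomial

/-! ### Extreme degrees of the coefficients, and degree bounds -/

section Corner

/-- With `ε = 1` (`ε = -1`), the maximal (minimal) degree of the constant term of `π` is positive
(negative), and it is strictly larger (smaller) than those of the intermediate coefficients. -/
def CornerDominates {R : Type*} [Semiring R] (ε : ℤ) (π : Polynomial R[T;T⁻¹]) : Prop :=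
  ∃ d : ℤ, 0 < ε * d ∧ (π.coeff 0).coeff d ≠ 0 ∧
    (∀ j, (π.coeff 0).coeff j ≠ 0 → ε * j ≤ ε * d) ∧
    ∀ i, 1 ≤ i → i < π.natDegree → ∀ j, (π.coeff i).coeff j ≠ 0 → ε * j < ε * d

theorem posDeg_eq_coe {R : Type*} [Semiring R] {a : R[T;T⁻¹]} {d : ℤ} (hd : a.coeff d ≠ 0)
    (h : ∀ j, a.coeff j ≠ 0 → j ≤ d) : posDeg a = d :=
  le_antisymm (Finset.max_le fun j hj => WithBot.coe_le_coe.2 (h j (Finsupp.mem_support_iff.1 hj)))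
    (Finset.le_max (Finsupp.mem_support_iff.2 hd))

theorem negDeg_eq_coe {R : Type*} [Semiring R] {a : R[T;T⁻¹]} {d : ℤ} (hd : a.coeff d ≠ 0)
    (h : ∀ j, a.coeff j ≠ 0 → d ≤ j) : negDeg a = d :=
  le_antisymm (Finset.min_le (Finsupp.mem_support_iff.2 hd))
    (Finset.le_min fun j hj => WithTop.coe_le_coe.2 (h j (Finsupp.mem_support_iff.1 hj)))

theorem posDeg_lt_coe_iff {R : Type*} [Semiring R] {a : R[T;T⁻¹]} {d : ℤ} :
    posDeg a < d ↔ ∀ j, a.coeff j ≠ 0 → j < d := by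
  rw [posDeg, Finset.max_eq_sup_coe, Finset.sup_lt_iff (WithBot.bot_lt_coe d)]
  simp

theorem coe_lt_negDeg_iff {R : Type*} [Semiring R] {a : R[T;T⁻¹]} {d : ℤ} :
    d < negDeg a ↔ ∀ j, a.coeff j ≠ 0 → d < j := by
  rw [negDeg, Finset.min_eq_inf_withTop, Finset.lt_inf_iff (WithTop.coe_lt_top d)]
  simp

theorem expansivePoly_iff {R : Type*} [Semiring R] (π : Polynomial R[T;T⁻¹]) :
    ExpansivePoly π ↔ CornerDominates 1 π ∧ CornerDominates (-1) π := by
  constructor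
  · rintro ⟨h0, ⟨hp, hpi⟩, hn, hni⟩
    have hne : (π.coeff 0).coeff.support.Nonempty := by
      rw [Finsupp.support_nonempty_iff]
      exact fun h => h0 (AddMonoidAlgebra.coeff_injective h)
    obtain ⟨d, hd⟩ := Finset.max_of_nonempty hne
    obtain ⟨e, he⟩ := Finset.min_of_nonempty hne
    have hd' : posDeg (π.coeff 0) = d := hd
    have he' : negDeg (π.coeff 0) = e := he
    rw [hd'] at hp hpi
    rw [he'] at hn hni
    refine ⟨⟨d, by simpa using WithBot.coe_lt_coe.1 hp,
      Finsupp.mem_support_iff.1 (Finset.mem_of_max hd), fun j hj => ?_, fun i h1 h2 j hj => ?_⟩,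
      ⟨e, by simpa using WithTop.coe_lt_coe.1 hn,
      Finsupp.mem_support_iff.1 (Finset.mem_of_min he), fun j hj => ?_, fun i h1 h2 j hj => ?_⟩⟩
    · simpa using Finset.le_max_of_eq (Finsupp.mem_support_iff.2 hj) hd
    · simpa using posDeg_lt_coe_iff.1 (hpi i h1 h2) j hj
    · simpa using Finset.min_le_of_eq (Finsupp.mem_support_iff.2 hj) he
    · simpa using coe_lt_negDeg_iff.1 (hni i h1 h2) j hj
  · rintro ⟨⟨d, hd0, hd, hdj, hdi⟩, e, he0, he, hej, hei⟩
    simp only [one_mul, neg_one_mul, neg_le_neg_iff, neg_lt_neg_iff, neg_pos] at *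
    refine ⟨fun h => hd (by simp [h]), ?_⟩
    rw [posDeg_eq_coe hd hdj, negDeg_eq_coe he hej]
    exact ⟨⟨WithBot.coe_lt_coe.2 hd0, fun i h1 h2 => posDeg_lt_coe_iff.2 (hdi i h1 h2)⟩,
      WithTop.coe_lt_coe.2 he0, fun i h1 h2 => coe_lt_negDeg_iff.2 (hei i h1 h2)⟩

end Corner

section SupportBound

variable {R : Type*} [CommRing R]

/-- All monomials have degree in `[-k, k]`. -/
def DegreeBounded (k : ℕ) (a : R[T;T⁻¹]) : Prop :=
  a ∈ AddMonoidAlgebra.supported R R (Set.Icc (-k : ℤ) k)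

theorem degreeBounded_iff {k : ℕ} {a : R[T;T⁻¹]} :
    DegreeBounded k a ↔ ∀ j, a.coeff j ≠ 0 → j.natAbs ≤ k := by
  simp only [DegreeBounded, AddMonoidAlgebra.supported, Submodule.mem_comap,
    Finsupp.mem_supported]
  refine forall_congr' fun j => ?_
  simp only [LinearEquiv.coe_coe, AddMonoidAlgebra.coeffLinearEquiv_apply, Finset.mem_coe,
    Finsupp.mem_support_iff, Set.mem_Icc]
  exact imp_congr_right fun _ => by omega

theorem DegreeBounded.mul {k l : ℕ} {a b : R[T;T⁻¹]} (ha : DegreeBounded k a)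
    (hb : DegreeBounded l b) : DegreeBounded (k + l) (a * b) := by
  rw [degreeBounded_iff] at *
  intro j hj
  classical
  have := AddMonoidAlgebra.support_coeff_mul_subset _ _ (Finsupp.mem_support_iff.2 hj)
  obtain ⟨x, hx, y, hy, rfl⟩ := Finset.mem_add.1 this
  have := ha x (Finsupp.mem_support_iff.1 hx)
  have := hb y (Finsupp.mem_support_iff.1 hy)
  omega

theorem DegreeBounded.prod {ι : Type*} {k : ℕ} (s : Finset ι) {f : ι → R[T;T⁻¹]}
    (h : ∀ i ∈ s, DegreeBounded k (f i)) : DegreeBounded (s.card * k) (∏ i ∈ s, f i) := by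
  classical
  induction s using Finset.induction_on with
  | empty =>
    rw [degreeBounded_iff]
    intro j hj
    by_contra hlt
    refine hj ?_
    rw [Finset.prod_empty, ← T_zero, T_apply, if_neg (by omega)]
  | insert i s hi ih =>
    rw [Finset.prod_insert hi, Finset.card_insert_of_notMem hi, add_mul, one_mul, add_comm]
    exact (h i (Finset.mem_insert_self _ _)).mul
      (ih fun j hj => h j (Finset.mem_insert_of_mem hj))

theorem DegreeBounded.det {n k : ℕ} {A : Matrix (Fin n) (Fin n) R[T;T⁻¹]}
    (h : ∀ i j, DegreeBounded k (A i j)) : DegreeBounded (n * k) A.det := by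
  rw [Matrix.det_apply]
  refine Submodule.sum_mem _ fun σ _ => ?_
  have := DegreeBounded.prod Finset.univ (k := k) (f := fun i => A (σ i) i) fun i _ => h _ _
  rw [Finset.card_univ, Fintype.card_fin] at this
  rcases Int.units_eq_one_or (Equiv.Perm.sign σ) with hs | hs
  · rw [hs, one_smul]
    exact this
  · rw [hs, Units.neg_smul, one_smul]
    exact Submodule.neg_mem _ this

theorem DegreeBounded.charpoly_coeff_zero {n k : ℕ} {A : Matrix (Fin n) (Fin n) R[T;T⁻¹]}
    (h : ∀ i j, DegreeBounded k (A i j)) : DegreeBounded (n * k) (A.charpoly.coeff 0) := by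
  have hdet := DegreeBounded.det h
  rw [Matrix.det_eq_sign_charpoly_coeff] at hdet
  have hsq : A.charpoly.coeff 0 =
      (-1) ^ Fintype.card (Fin n) * ((-1) ^ Fintype.card (Fin n) * A.charpoly.coeff 0) := by
    rw [← mul_assoc, ← mul_pow]
    simp
  rw [hsq]
  rcases neg_one_pow_eq_or R[T;T⁻¹] (Fintype.card (Fin n)) with hs | hs
  · rw [hs, one_mul] at hdet ⊢
    rwa [one_mul]
  · rw [hs, neg_one_mul] at hdet ⊢
    rw [neg_one_mul]
    exact Submodule.neg_mem _ hdet

end SupportBound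

end LinearCA

namespace LinearCA

open LaurentPolynomial

/-! ### Duality with Laurent vectors; sufficiency by Cayley–Hamilton -/

section Pairing

variable {K : Type*} [CommRing K] {n : ℕ}

/-- The functional on Laurent vectors defined by a configuration: it sends `T ^ s` times the `k`-th
unit vector to the `k`-th entry of the configuration at `-s`. -/
noncomputable def pairing (c : ℤ → Fin n → K) : (Fin n → K[T;T⁻¹]) →ₗ[K] K :=
  ∑ k, Finsupp.linearCombination K (fun j : ℤ => c (-j) k) ∘ₗ
    (AddMonoidAlgebra.coeffLinearEquiv K).toLinearMap ∘ₗ LinearMap.proj k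

theorem pairing_apply (c : ℤ → Fin n → K) (f : Fin n → K[T;T⁻¹]) :
    pairing c f = ∑ k, (f k).coeff.sum fun j a => a * c (-j) k := by
  simp [pairing, Finsupp.linearCombination_apply]

theorem pairing_single (c : ℤ → Fin n → K) (k : Fin n) (α : K[T;T⁻¹]) :
    pairing c (Pi.single k α) = α.coeff.sum fun j a => a * c (-j) k := by
  rw [pairing_apply, Finset.sum_eq_single k (fun i _ hi => by simp [Pi.single_eq_of_ne hi])
    (by simp), Pi.single_eq_same]

theorem pairing_single_single (c : ℤ → Fin n → K) (k : Fin n) (s : ℤ) (a : K) :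
    pairing c (Pi.single k (AddMonoidAlgebra.single s a)) = a * c (-s) k := by
  rw [pairing_single, AddMonoidAlgebra.coeff_single, Finsupp.sum_single_index (by simp)]

theorem pairing_single_mul_T (c : ℤ → Fin n → K) (k : Fin n) (s : ℤ) (α : K[T;T⁻¹]) :
    pairing c (Pi.single k (α * T s)) = α.coeff.sum fun j a => a * c (-(j + s)) k := by
  induction α using AddMonoidAlgebra.induction_linear with
  | zero => simp
  | add f g hf hg =>
    rw [add_mul, Pi.single_add, map_add, hf, hg, AddMonoidAlgebra.coeff_add,
      Finsupp.sum_add_index' (by simp) (by intros; ring)]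
  | single j a =>
    rw [T, AddMonoidAlgebra.single_mul_single, pairing_single_single,
      AddMonoidAlgebra.coeff_single, Finsupp.sum_single_index (by simp), mul_one]

theorem pi_laurent_linearMap_ext {V : Type*} [AddCommGroup V] [Module K V]
    {f g : (Fin n → K[T;T⁻¹]) →ₗ[K] V}
    (h : ∀ k s, f (Pi.single k (T s)) = g (Pi.single k (T s))) : f = g := by
  refine LinearMap.pi_ext' fun k => AddMonoidAlgebra.lhom_ext' fun s => ?_
  ext
  exact h k s

theorem exists_eq_pairing (φ : (Fin n → K[T;T⁻¹]) →ₗ[K] K) : ∃ c, φ = pairing c := by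
  refine ⟨fun j k => φ (Pi.single k (T (-j))), pi_laurent_linearMap_ext fun k s => ?_⟩
  rw [T, pairing_single_single, neg_neg, one_mul]
  rfl

end Pairing

namespace LinearRule

variable {m n : ℕ} (A : LinearRule m n)

/-- The matrix carries `X^{-z}` and the pairing reads `T^s` at cell `-s`, so the two signs cancel
and `A_z` meets the cell at offset `+z`. -/
theorem pairing_vecMul (c : ℤ → Fin n → ZMod m) (f : Fin n → (ZMod m)[T;T⁻¹]) :
    pairing c (Matrix.vecMul f A.assocMatrix) = pairing (A.automatonHom c) f := by
  suffices h : (pairing c) ∘ₗ (A.assocMatrix.vecMulLinear.restrictScalars (ZMod m)) =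
      pairing (A.automatonHom c) from LinearMap.congr_fun h f
  refine pi_laurent_linearMap_ext fun k s => ?_
  rw [LinearMap.comp_apply, LinearMap.restrictScalars_apply, Matrix.vecMulLinear_apply,
    Matrix.single_vecMul, T, pairing_single_single, one_mul, automatonHom_apply, automaton_apply,
    Finset.sum_apply]
  have hrow : (AddMonoidAlgebra.single s 1 : (ZMod m)[T;T⁻¹]) • A.assocMatrix.row k =
      ∑ l, ∑ z : Fin (2 * A.radius + 1), Pi.single l
        (AddMonoidAlgebra.single (s - ((z : ℤ) - A.radius)) (A.mat z k l)) := by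
    rw [← Finset.univ_sum_single (_ • A.assocMatrix.row k)]
    refine Finset.sum_congr rfl fun l _ => ?_
    refine Eq.trans ?_ (map_sum (AddMonoidHom.single (fun _ : Fin n => (ZMod m)[T;T⁻¹]) l) _ _)
    refine congrArg (Pi.single l) ?_
    simp only [Pi.smul_apply, Matrix.row, assocMatrix, Matrix.of_apply, smul_eq_mul,
      Finset.mul_sum]
    refine Finset.sum_congr rfl fun z _ => ?_
    rw [← single_eq_C_mul_T, AddMonoidAlgebra.single_mul_single, one_mul, ← sub_eq_add_neg]
  rw [hrow]
  simp only [map_sum, pairing_single_single, Matrix.mulVec, dotProduct]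
  rw [Finset.sum_comm]
  refine Finset.sum_congr rfl fun z _ => Finset.sum_congr rfl fun l _ => ?_
  rw [neg_sub, sub_eq_neg_add]

theorem pairing_vecMul_pow (c : ℤ → Fin n → ZMod m) (f : Fin n → (ZMod m)[T;T⁻¹]) (l : ℕ) :
    pairing c (Matrix.vecMul f (A.assocMatrix ^ l)) = pairing ((A.automatonHom ^ l) c) f := by
  induction l generalizing c with
  | zero => simp
  | succ l ih =>
    rw [pow_succ, ← Matrix.vecMul_vecMul, pairing_vecMul, ih, ← Module.End.mul_apply, ← pow_succ]

theorem sum_pairing_charpoly_eq_zero (c : ℤ → Fin n → ZMod m) (k : Fin n) (s : ℤ) :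
    ∑ l ∈ Finset.range (A.assocMatrix.charpoly.natDegree + 1),
      (A.assocMatrix.charpoly.coeff l).coeff.sum
        (fun j a => a * (A.automatonHom ^ l) c (-(j + s)) k) = 0 := by
  have h := congrArg (fun B => pairing c (Matrix.vecMul (Pi.single k (T s)) B))
    A.assocMatrix.aeval_self_charpoly
  simp only [Polynomial.aeval_eq_sum_range, Matrix.vecMul_sum, Matrix.vecMul_zero, map_zero,
    map_sum] at h
  rw [← h]
  refine Finset.sum_congr rfl fun l _ => ?_
  rw [Matrix.vecMul_smul, ← Matrix.smul_vecMul, pairing_vecMul_pow, ← Pi.single_smul, smul_eq_mul,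
    pairing_single_mul_T]

theorem degreeBounded_assocMatrix (i j : Fin n) : DegreeBounded A.radius (A.assocMatrix i j) := by
  simp only [assocMatrix, Matrix.of_apply]
  refine Submodule.sum_mem _ fun z _ => degreeBounded_iff.2 fun x hx => ?_
  have := support_C_mul_T _ _ (Finsupp.mem_support_iff.2 hx)
  rw [Finset.mem_singleton] at this
  omega

end LinearRule

namespace LinearRule

variable {p n : ℕ} [Fact p.Prime] (A : LinearRule p n)

theorem eq_zero_of_charpoly_corner {N : ℕ} {d t : ℤ}
    (hd : (A.assocMatrix.charpoly.coeff 0).coeff d ≠ 0)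
    (h : ∀ l ≤ n, ∀ j, (A.assocMatrix.charpoly.coeff l).coeff j ≠ 0 →
      (l = 0 ∧ j = d) ∨ (t + d - j).natAbs ≤ N)
    {c : ℤ → Fin n → ZMod p}
    (hc : ∀ l ≤ n, ∀ j : ℤ, j.natAbs ≤ N → (A.automatonHom ^ l) c j = 0) : c t = 0 := by
  funext k
  -- With this shift the monomial `T^j` reads cell `t + d - j`; in particular `T^d` reads `t`, and
  -- every other term lies in the window.
  have key := A.sum_pairing_charpoly_eq_zero c k (-t - d)
  have hdeg : A.assocMatrix.charpoly.natDegree = n := by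
    rw [Matrix.charpoly_natDegree_eq_dim, Fintype.card_fin]
  have hz : ∀ l ≤ n, ∀ j, (A.assocMatrix.charpoly.coeff l).coeff j ≠ 0 → ¬ (l = 0 ∧ j = d) →
      (A.assocMatrix.charpoly.coeff l).coeff j * (A.automatonHom ^ l) c (-(j + (-t - d))) k
        = 0 := by
    intro l hl j hj hne
    have := (h l hl j hj).resolve_left hne
    rw [hc l hl _ (by omega), Pi.zero_apply, mul_zero]
  rw [hdeg, Finset.sum_eq_single 0, Finsupp.sum, Finset.sum_eq_single d] at key
  · have hc0 := (mul_eq_zero.1 key).resolve_left hd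
    rwa [show -(d + (-t - d)) = t by ring] at hc0
  · exact fun j hj hne => hz 0 (Nat.zero_le _) j (Finsupp.mem_support_iff.1 hj) fun h => hne h.2
  · exact fun h => (h (Finsupp.mem_support_iff.2 hd)).elim
  · exact fun l hl hne => Finset.sum_eq_zero fun j hj =>
      hz l (by simpa [Nat.lt_succ_iff] using hl) j (Finsupp.mem_support_iff.1 hj) fun h => hne h.1
  · simp

theorem windowGrows_of_expansiveMatrix (hA : ExpansiveMatrix A.assocMatrix) :
    A.WindowGrows (n * A.radius) n := by
  obtain ⟨⟨d, hd0, hd, hdj, hdi⟩, e, he0, he, hej, hei⟩ := (expansivePoly_iff _).1 hA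
  simp only [one_mul, neg_one_mul, neg_le_neg_iff, neg_lt_neg_iff, neg_pos] at *
  have hdeg : A.assocMatrix.charpoly.natDegree = n := by
    rw [Matrix.charpoly_natDegree_eq_dim, Fintype.card_fin]
  have hb := degreeBounded_iff.1
    (DegreeBounded.charpoly_coeff_zero A.degreeBounded_assocMatrix)
  generalize n * A.radius = N at hb ⊢
  have hd' := hb d hd
  have he' := hb e he
  have hl : ∀ l ≤ n, ∀ j, (A.assocMatrix.charpoly.coeff l).coeff j ≠ 0 →
      (l = 0 ∧ e ≤ j ∧ j ≤ d) ∨ (e < j ∧ j < d) := by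
    intro l hln j hj
    rcases Nat.eq_zero_or_pos l with rfl | hpos
    · exact Or.inl ⟨rfl, hej j hj, hdj j hj⟩
    rcases hln.lt_or_eq with hlt | rfl
    · exact Or.inr ⟨hei l hpos (hlt.trans_eq hdeg.symm) j hj,
        hdi l hpos (hlt.trans_eq hdeg.symm) j hj⟩
    -- The leading coefficient has only degree 0, strictly inside because `e < 0 < d`.
    · have h1 : A.assocMatrix.charpoly.coeff l = 1 := by
        have := A.assocMatrix.charpoly_monic.coeff_natDegree
        rwa [hdeg] at this
      rw [h1, ← T_zero, T_apply] at hj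
      have : (0 : ℤ) = j := by
        by_contra hne
        simp [hne] at hj
      omega
  -- Degrees are reversed by the pairing, so the right end `N + 1` is governed by the lowest degree
  -- `e`. Since `d - e ≤ 2 * N`, the remaining cells do not leave the window on the other side.
  refine fun c hc => ⟨A.eq_zero_of_charpoly_corner he (fun l hln j hj => ?_) hc,
    A.eq_zero_of_charpoly_corner hd (fun l hln j hj => ?_) hc⟩
  · have := hl l hln j hj
    omega
  · have := hl l hln j hj
    omega

end LinearRule

end LinearCA

namespace LinearCA

open LaurentPolynomial

/-! ### Necessity: valuations of the eigenvalues -/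

section Valuation

theorem valuation_algebraMap_zmod {p : ℕ} [Fact p.Prime] {L : Type*} [Field L] [Algebra (ZMod p) L]
    (O : ValuationSubring L) {a : ZMod p} (ha : a ≠ 0) :
    O.valuation (algebraMap (ZMod p) L a) = 1 := by
  have hle : ∀ b : ZMod p, O.valuation (algebraMap (ZMod p) L b) ≤ 1 := by
    intro b
    obtain ⟨k, rfl⟩ := ZMod.natCast_zmod_surjective b
    rw [map_natCast, O.valuation_le_one_iff]
    exact natCast_mem O k
  refine le_antisymm (hle a) ?_
  have h := hle a⁻¹
  rw [map_inv₀, map_inv₀] at h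
  exact (inv_le_one₀ (zero_lt_iff.2 (by simpa using ha))).1 h

/-- The intersection of all valuation rings of `L` is the integral closure of the prime subring, and
that subring is contained in the image of `ZMod p`. -/
theorem exists_valuationSubring_one_lt {p : ℕ} [Fact p.Prime] {L : Type*} [Field L]
    [Algebra (ZMod p) L] {x : L} (hx : ¬ IsIntegral (ZMod p) x) :
    ∃ O : ValuationSubring L, 1 < O.valuation x := by
  by_contra! hO
  refine hx ?_
  have hmem : x ∈ (integralClosure (Subring.closure (∅ : Set L)) L).toSubring := by
    rw [← iInf_valuationSubring_superset, Subring.mem_iInf]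
    exact fun V => (V.1.valuation_le_one_iff x).1 (hO V.1)
  have hint : IsIntegral (Subring.closure (∅ : Set L)) x := hmem
  have hle : Subring.closure (∅ : Set L) ≤ (algebraMap (ZMod p) L).range := by simp
  obtain ⟨P, hP, hPx⟩ := hint
  have hlift : P.map (algebraMap (Subring.closure (∅ : Set L)) L) ∈
      Polynomial.lifts (algebraMap (ZMod p) L) := by
    rw [Polynomial.lifts_iff_coeff_lifts]
    intro i
    rw [Polynomial.coeff_map]
    exact hle (P.coeff i).2
  obtain ⟨Q, hQ, -, hQm⟩ := Polynomial.lifts_and_natDegree_eq_and_monic hlift (hP.map _)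
  refine ⟨Q, hQm, ?_⟩
  rw [← Polynomial.eval_map, hQ, Polynomial.eval_map]
  exact hPx

/-- Multiplying `q` by `X - x` makes the constant term `-x * q₀` and the others `q_i - x * q_{i+1}`;
both parts of the latter are smaller than `x * q₀` as `v x > 1`. -/
theorem coeff_lt_coeff_zero_of_one_lt {L Γ : Type*} [Field L] [LinearOrderedCommGroupWithZero Γ]
    (v : Valuation L Γ) (s : Multiset L) (hs : ∀ x ∈ s, 1 < v x) :
    ∀ i, 1 ≤ i → v ((s.map fun x => Polynomial.X - Polynomial.C x).prod.coeff i) <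
      v ((s.map fun x => Polynomial.X - Polynomial.C x).prod.coeff 0) := by
  induction s using Multiset.induction_on with
  | empty =>
    intro i hi
    simp [Polynomial.coeff_one, show i ≠ 0 by omega]
  | cons x s ih =>
    have ih := ih fun y hy => hs y (Multiset.mem_cons_of_mem hy)
    have hx := hs x (Multiset.mem_cons_self x s)
    rw [Multiset.map_cons, Multiset.prod_cons]
    set q := (s.map fun x => Polynomial.X - Polynomial.C x).prod
    have hq : 0 < v (q.coeff 0) := zero_le.trans_lt (ih 1 le_rfl)
    have hlt : v (q.coeff 0) < v x * v (q.coeff 0) := lt_mul_of_one_lt_left hq hx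
    intro i hi
    obtain ⟨i, rfl⟩ := Nat.exists_eq_add_of_le' hi
    rw [sub_mul, Polynomial.coeff_sub, Polynomial.coeff_sub, Polynomial.coeff_X_mul,
      Polynomial.coeff_C_mul, Polynomial.coeff_C_mul, Polynomial.mul_coeff_zero,
      Polynomial.coeff_X_zero, zero_mul, zero_sub, Valuation.map_neg, map_mul]
    refine v.map_sub_lt ?_ ?_
    · rcases Nat.eq_zero_or_pos i with rfl | hpos
      · exact hlt
      · exact (ih i hpos).trans hlt
    · rw [map_mul]
      exact mul_lt_mul_of_pos_left (ih (i + 1) (by omega)) (zero_lt_one.trans hx)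

end Valuation

section LaurentValuation

variable {p : ℕ} [Fact p.Prime] {L : Type*} [Field L] [Algebra (ZMod p)[T;T⁻¹] L]

theorem not_isIntegral_T {ε : ℤ} (hε : ε = 1 ∨ ε = -1) :
    ¬ IsIntegral (ZMod p) (T ε : (ZMod p)[T;T⁻¹]) := by
  have h1 : ¬ IsIntegral (ZMod p) (T 1 : (ZMod p)[T;T⁻¹]) := by
    rintro ⟨P, hP, hPx⟩
    refine hP.ne_zero (Polynomial.toLaurent_injective ?_)
    rw [map_zero, ← hPx, ← Polynomial.toLaurentAlg_apply, ← Polynomial.toLaurent_X,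
      ← Polynomial.toLaurentAlg_apply]
    have := Polynomial.aeval_algHom_apply Polynomial.toLaurentAlg Polynomial.X P
    rw [Polynomial.aeval_X_left_apply] at this
    exact this.symm
  rcases hε with rfl | rfl
  · exact h1
  · intro h
    refine h1 ?_
    have := h.map (invert : (ZMod p)[T;T⁻¹] ≃ₐ[ZMod p] _)
    simpa using this

theorem valuation_T (v : ValuationSubring L) {ε : ℤ} (hε : ε = 1 ∨ ε = -1) (j : ℤ) :
    v.valuation (algebraMap (ZMod p)[T;T⁻¹] L (T j)) =
      v.valuation (algebraMap (ZMod p)[T;T⁻¹] L (T ε)) ^ (ε * j) := by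
  have hnat : ∀ (e : ℤ) (k : ℕ), v.valuation (algebraMap (ZMod p)[T;T⁻¹] L (T (k * e))) =
      v.valuation (algebraMap (ZMod p)[T;T⁻¹] L (T e)) ^ k := by
    intro e k
    rw [← T_pow, map_pow, map_pow]
  have hinv : ∀ e : ℤ, v.valuation (algebraMap (ZMod p)[T;T⁻¹] L (T (-e))) =
      (v.valuation (algebraMap (ZMod p)[T;T⁻¹] L (T e)))⁻¹ := by
    intro e
    refine eq_inv_of_mul_eq_one_left ?_
    rw [← map_mul, ← map_mul, ← T_add, neg_add_cancel, T_zero, map_one, map_one]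
  have hj : j = ε * (ε * j) := by
    rcases hε with rfl | rfl <;> ring
  generalize ε * j = i at hj
  subst hj
  rcases Int.eq_nat_or_neg i with ⟨k, rfl | rfl⟩
  · rw [mul_comm, hnat, zpow_natCast]
  · rw [mul_neg, hinv, mul_comm, hnat, zpow_neg, zpow_natCast]

variable [Algebra (ZMod p) L] [IsScalarTower (ZMod p) (ZMod p)[T;T⁻¹] L]

/-- Nonzero constants have valuation 1, so distinct monomials have distinct valuations and the
largest one wins. -/
theorem valuation_eq_zpow (v : ValuationSubring L) {ε : ℤ} (hε : ε = 1 ∨ ε = -1)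
    (hv : 1 < v.valuation (algebraMap (ZMod p)[T;T⁻¹] L (T ε))) {α : (ZMod p)[T;T⁻¹]} {d : ℤ}
    (hd : α.coeff d ≠ 0) (hmax : ∀ j, α.coeff j ≠ 0 → ε * j ≤ ε * d) :
    v.valuation (algebraMap (ZMod p)[T;T⁻¹] L α) =
      v.valuation (algebraMap (ZMod p)[T;T⁻¹] L (T ε)) ^ (ε * d) := by
  have hterm : ∀ j, α.coeff j ≠ 0 →
      v.valuation (algebraMap (ZMod p)[T;T⁻¹] L (C (α.coeff j) * T j)) =
      v.valuation (algebraMap (ZMod p)[T;T⁻¹] L (T ε)) ^ (ε * j) := by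
    intro j hj
    rw [map_mul, map_mul, C_eq_algebraMap, ← IsScalarTower.algebraMap_apply,
      valuation_algebraMap_zmod _ hj, one_mul, valuation_T v hε]
  have hsum : α = ∑ j ∈ α.coeff.support, C (α.coeff j) * T j := by
    conv_lhs => rw [← AddMonoidAlgebra.sum_coeff_single α]
    simp only [Finsupp.sum, single_eq_C_mul_T]
  conv_lhs => rw [hsum, map_sum]
  rw [v.valuation.map_sum_eq_of_lt (Finsupp.mem_support_iff.2 hd), hterm d hd]
  intro j hj
  rw [Finset.mem_sdiff, Finsupp.mem_support_iff, Finset.mem_singleton] at hj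
  rw [hterm j hj.1, hterm d hd]
  refine zpow_lt_zpow_right₀ hv (lt_of_le_of_ne (hmax j hj.1) fun h => hj.2 ?_)
  rcases hε with rfl | rfl <;> omega

theorem exists_extremal_degree (ε : ℤ) {α : (ZMod p)[T;T⁻¹]} (hα : α ≠ 0) :
    ∃ d, α.coeff d ≠ 0 ∧ ∀ j, α.coeff j ≠ 0 → ε * j ≤ ε * d := by
  have hne : α.coeff.support.Nonempty := by
    rw [Finsupp.support_nonempty_iff]
    exact fun h => hα (AddMonoidAlgebra.coeff_injective h)
  obtain ⟨d, hd, h⟩ := Finset.exists_max_image _ (fun j => ε * j) hne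
  exact ⟨d, Finsupp.mem_support_iff.1 hd, fun j hj => h j (Finsupp.mem_support_iff.2 hj)⟩

theorem cornerDominates_of_valuation_lt (v : ValuationSubring L) {ε : ℤ} (hε : ε = 1 ∨ ε = -1)
    (hv : 1 < v.valuation (algebraMap (ZMod p)[T;T⁻¹] L (T ε)))
    {π : Polynomial (ZMod p)[T;T⁻¹]} (hπ : π.Monic) (hdeg : 1 ≤ π.natDegree)
    (h : ∀ i, 1 ≤ i → v.valuation (algebraMap (ZMod p)[T;T⁻¹] L (π.coeff i)) <
      v.valuation (algebraMap (ZMod p)[T;T⁻¹] L (π.coeff 0))) : CornerDominates ε π := by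
  have h0 : π.coeff 0 ≠ 0 := by
    intro h0
    have := h 1 le_rfl
    rw [h0, map_zero, map_zero] at this
    exact not_lt_zero this
  obtain ⟨d, hd, hmax⟩ := exists_extremal_degree ε h0
  have hval := valuation_eq_zpow v hε hv hd hmax
  rw [hval] at h
  have hlt : ∀ i, 1 ≤ i → ∀ j, (π.coeff i).coeff j ≠ 0 → ε * j < ε * d := by
    intro i hi j hj
    obtain ⟨e, he, hemax⟩ := exists_extremal_degree ε (α := π.coeff i)
      (by rintro h; simp [h] at hj)
    have := h i hi
    rw [valuation_eq_zpow v hε hv he hemax] at this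
    exact (hemax j hj).trans_lt ((zpow_lt_zpow_iff_right₀ hv).1 this)
  refine ⟨d, ?_, hd, hmax, fun i hi _ => hlt i hi⟩
  -- Domination over the leading coefficient 1, of degree 0, is what gives `0 < ε * d`.
  have := hlt π.natDegree hdeg 0 (by rw [hπ.coeff_natDegree, ← T_zero, T_apply]; simp)
  simpa using this

end LaurentValuation

namespace LinearRule

variable {p n : ℕ} [Fact p.Prime] (A : LinearRule p n)

theorem span_visible_eq_top {N : ℕ} (hN : A.invisible N = ⊥) :
    Submodule.span (ZMod p) {f | ∃ (l : ℕ) (j : ℤ) (k : Fin n), j.natAbs ≤ N ∧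
      f = Matrix.vecMul (Pi.single k (T j)) (A.assocMatrix ^ l)} = ⊤ := by
  by_contra hne
  obtain ⟨φ, hφ, hle⟩ := Submodule.exists_le_ker_of_lt_top _ (lt_top_iff_ne_top.2 hne)
  obtain ⟨c, rfl⟩ := exists_eq_pairing φ
  refine hφ ?_
  have hc : c = 0 := by
    refine (Submodule.eq_bot_iff _).1 hN c fun l j hj => ?_
    funext k
    have := hle (Submodule.subset_span ⟨l, -j, k, by simpa using hj, rfl⟩)
    rw [LinearMap.mem_ker, pairing_vecMul_pow, T, pairing_single_single, one_mul, neg_neg] at this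
    exact this
  subst hc
  refine pi_laurent_linearMap_ext fun k s => ?_
  rw [T, pairing_single_single]
  simp

theorem one_lt_valuation_of_root {L : Type*} [Field L] [Algebra (ZMod p) L]
    [Algebra (ZMod p)[T;T⁻¹] L] [IsScalarTower (ZMod p) (ZMod p)[T;T⁻¹] L]
    (v : ValuationSubring L) {ε : ℤ} (hε : ε = 1 ∨ ε = -1)
    (hv : 1 < v.valuation (algebraMap (ZMod p)[T;T⁻¹] L (T ε)))
    {N : ℕ} (hN : A.invisible N = ⊥) {x : L}
    (hx : (A.assocMatrix.map (algebraMap (ZMod p)[T;T⁻¹] L)).charpoly.IsRoot x) :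
    1 < v.valuation x := by
  by_contra! hle
  rw [Polynomial.IsRoot, Matrix.eval_charpoly, ← Matrix.exists_mulVec_eq_zero_iff] at hx
  obtain ⟨w, hw0, hw⟩ := hx
  set φ := algebraMap (ZMod p)[T;T⁻¹] L
  set u := v.valuation (φ (T ε))
  rw [Matrix.sub_mulVec, sub_eq_zero, Matrix.scalar_apply, ← Matrix.smul_one_eq_diagonal,
    Matrix.smul_mulVec, Matrix.one_mulVec] at hw
  -- Pairing with the eigenvector `w` turns right multiplication by the matrix into multiplication
  -- by `x`.
  let ψ : (Fin n → (ZMod p)[T;T⁻¹]) →ₗ[ZMod p] L :=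
    { toFun := fun f => ∑ k, φ (f k) * w k
      map_add' := fun f g => by simp [add_mul, Finset.sum_add_distrib]
      map_smul' := fun a f => by
        simp only [Pi.smul_apply, RingHom.id_apply, Algebra.smul_def a, map_mul,
          mul_assoc]
        simp only [φ, ← IsScalarTower.algebraMap_apply, Finset.mul_sum] }
  have hψ : ∀ f, ψ f = ∑ k, φ (f k) * w k := fun _ => rfl
  have hψA : ∀ f, ψ (Matrix.vecMul f A.assocMatrix) = x * ψ f := by
    intro f
    have h1 : ψ (Matrix.vecMul f A.assocMatrix) =
        dotProduct (Matrix.vecMul (φ ∘ f) (A.assocMatrix.map φ)) w := by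
      rw [hψ, dotProduct]
      refine Finset.sum_congr rfl fun k _ => ?_
      rw [← RingHom.map_vecMul]
    rw [h1, ← Matrix.dotProduct_mulVec, ← hw, dotProduct_smul, smul_eq_mul]
    rfl
  have hψA_pow : ∀ (l : ℕ) f, ψ (Matrix.vecMul f (A.assocMatrix ^ l)) = x ^ l * ψ f := by
    intro l
    induction l with
    | zero => simp
    | succ l ih =>
      intro f
      rw [pow_succ, ← Matrix.vecMul_vecMul, hψA, ih, pow_succ]
      ring
  have hψs : ∀ k j, v.valuation (ψ (Pi.single k (T j))) = u ^ (ε * j) * v.valuation (w k) := by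
    intro k j
    rw [hψ, Finset.sum_eq_single k (fun i _ hi => by simp [Pi.single_eq_of_ne hi]) (by simp),
      Pi.single_eq_same, map_mul, valuation_T v hε]
  obtain ⟨k₁, hk₁⟩ := Function.ne_iff.1 hw0
  have : Nonempty (Fin n) := ⟨k₁⟩
  obtain ⟨k₀, hk₀⟩ := Finite.exists_max fun k => v.valuation (w k)
  have hpos : 0 < v.valuation (w k₀) := lt_of_lt_of_le (zero_lt_iff.2 (by simpa using hk₁)) (hk₀ k₁)
  -- On a spanning vector the factor `x ^ l` has valuation at most 1 and `|j| ≤ N`; the ultrametric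
  -- inequality extends the bound to the span, which is everything.
  have hbound : ∀ f, v.valuation (ψ f) ≤ u ^ (N : ℤ) * v.valuation (w k₀) := by
    intro f
    have hf : f ∈ Submodule.span (ZMod p) {f | ∃ (l : ℕ) (j : ℤ) (k : Fin n), j.natAbs ≤ N ∧
      f = Matrix.vecMul (Pi.single k (T j)) (A.assocMatrix ^ l)} := by
      rw [A.span_visible_eq_top hN]
      trivial
    induction hf using Submodule.span_induction with
    | mem f hf =>
      obtain ⟨l, j, k, hj, rfl⟩ := hf
      rw [hψA_pow, map_mul, hψs, map_pow]
      refine (mul_le_of_le_one_left' (pow_le_one' hle l)).trans (mul_le_mul' ?_ (hk₀ k))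
      refine zpow_le_zpow_right₀ hv.le ?_
      rcases hε with rfl | rfl <;> omega
    | zero => simp
    | add f g _ _ hf hg =>
      rw [map_add]
      exact (v.valuation.map_add _ _).trans (max_le hf hg)
    | smul a f _ hf =>
      rw [map_smul, Algebra.smul_def, map_mul]
      rcases eq_or_ne a 0 with rfl | ha
      · simp
      · rwa [valuation_algebraMap_zmod v ha, one_mul]
  -- One degree beyond the window, at the largest entry of `w`, the bound fails.
  have := hbound (Pi.single k₀ (T (ε * (N + 1))))
  rw [hψs] at this
  refine this.not_gt (mul_lt_mul_of_pos_right (zpow_lt_zpow_right₀ hv ?_) hpos)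
  rcases hε with rfl | rfl <;> omega

theorem cornerDominates_charpoly (hn : 1 ≤ n) {N : ℕ} (hN : A.invisible N = ⊥) {ε : ℤ}
    (hε : ε = 1 ∨ ε = -1) : CornerDominates ε A.assocMatrix.charpoly := by
  let L := AlgebraicClosure (FractionRing (ZMod p)[T;T⁻¹])
  have hinj : Function.Injective (algebraMap (ZMod p)[T;T⁻¹] L) := by
    rw [IsScalarTower.algebraMap_eq (ZMod p)[T;T⁻¹] (FractionRing (ZMod p)[T;T⁻¹]) L]
    exact (algebraMap (FractionRing (ZMod p)[T;T⁻¹]) L).injective.comp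
      (IsFractionRing.injective _ _)
  obtain ⟨v, hv⟩ := exists_valuationSubring_one_lt (p := p)
    (x := algebraMap (ZMod p)[T;T⁻¹] L (T ε)) fun h =>
      not_isIntegral_T hε ((isIntegral_algebraMap_iff hinj).1 h)
  refine cornerDominates_of_valuation_lt v hε hv A.assocMatrix.charpoly_monic
    (by rwa [Matrix.charpoly_natDegree_eq_dim, Fintype.card_fin]) fun i hi => ?_
  have hsplit := (IsAlgClosed.splits
    (A.assocMatrix.map (algebraMap (ZMod p)[T;T⁻¹] L)).charpoly).eq_prod_roots_of_monic
      (Matrix.charpoly_monic _)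
  have hroots := coeff_lt_coeff_zero_of_one_lt v.valuation
    (A.assocMatrix.map (algebraMap (ZMod p)[T;T⁻¹] L)).charpoly.roots
    (fun x hx => A.one_lt_valuation_of_root v hε hv hN (Polynomial.isRoot_of_mem_roots hx)) i hi
  rw [← hsplit, Matrix.charpoly_map, Polynomial.coeff_map, Polynomial.coeff_map] at hroots
  exact hroots

theorem expansiveMatrix_of_positivelyExpansive (hn : 1 ≤ n)
    (h : PositivelyExpansive A.automaton) : ExpansiveMatrix A.assocMatrix := by
  obtain ⟨N, hN⟩ := A.positivelyExpansive_iff.1 h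
  exact (expansivePoly_iff _).2 ⟨A.cornerDominates_charpoly hn hN (Or.inl rfl),
    A.cornerDominates_charpoly hn hN (Or.inr rfl)⟩

theorem positivelyExpansive_iff_expansiveMatrix (hn : 1 ≤ n) :
    PositivelyExpansive A.automaton ↔ ExpansiveMatrix A.assocMatrix :=
  ⟨A.expansiveMatrix_of_positivelyExpansive hn,
    fun h => (A.windowGrows_of_expansiveMatrix h).positivelyExpansive⟩

theorem positivelyExpansive_iff_windowGrows (hn : 1 ≤ n) :
    PositivelyExpansive A.automaton ↔ A.WindowGrows (n * A.radius) n :=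
  ⟨fun h => A.windowGrows_of_expansiveMatrix (A.expansiveMatrix_of_positivelyExpansive hn h),
    fun h => h.positivelyExpansive⟩

end LinearRule

theorem LinearRule.assocMatrix_reduce {m n q : ℕ} (h : q ∣ m) (A : LinearRule m n) :
    (A.reduce h).assocMatrix = reduceMod h A.assocMatrix := by
  ext1 i j
  simp only [LinearRule.assocMatrix, reduceMod, Matrix.map_apply, Matrix.of_apply, map_sum,
    LinearRule.reduce]
  refine Finset.sum_congr rfl fun k _ => ?_
  rw [← single_eq_C_mul_T, ← single_eq_C_mul_T, AddMonoidAlgebra.mapRingHom_single]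

theorem LinearRule.positivelyExpansive_iff_forall_expansiveMatrix {m n : ℕ} (hm : 1 < m)
    (hn : 1 ≤ n) (A : LinearRule m n) :
    PositivelyExpansive A.automaton ↔
      ∀ (p : ℕ) (_ : p.Prime) (h : p ∣ m), ExpansiveMatrix (reduceMod h A.assocMatrix) := by
  rw [A.positivelyExpansive_iff_forall_prime (by omega)]
  refine forall_congr' fun p => forall_congr' fun hp => forall_congr' fun h => ?_
  have : Fact p.Prime := ⟨hp⟩
  rw [(A.reduce h).positivelyExpansive_iff_expansiveMatrix hn, A.assocMatrix_reduce h]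

end LinearCA

namespace LinearCA

/-! ### The finite space-time check -/

section SpaceTime

/-- `u l i k` (time, position, component) is a space-time array of width `4 * (n * r) + 3` and
height `n + 1` evolving, modulo `p`, under the linear rule with entries `E`. -/
def Evolves (n r p : ℕ) (E u : ℕ → ℕ → ℕ → ℕ) : Prop :=
  ∀ l < n, ∀ i < 4 * (n * r) + 3 - 2 * r, ∀ k < n, u (l + 1) (i + r) k =
    (∑ z ∈ Finset.range (2 * r + 1), ∑ j ∈ Finset.range n, E z k j * u l (i + z) j) % p

/-- The array vanishes on its central window. -/
def VanishesOnWindow (n r : ℕ) (u : ℕ → ℕ → ℕ → ℕ) : Prop :=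
  ∀ l < n + 1, ∀ i < 2 * (n * r) + 1, ∀ k < n, u l (i + (n * r + 1)) k = 0

/-- The first row of the array vanishes on both sides of its central window. -/
def VanishesOnBorder (n r : ℕ) (u : ℕ → ℕ → ℕ → ℕ) : Prop :=
  ∀ k < n, u 0 (3 * (n * r) + 2) k = 0 ∧ u 0 (n * r) k = 0

/-- The array encoded by a number in base `p`. -/
def digitArray (p x l i k : ℕ) : ℕ := x / p ^ Nat.pair l (Nat.pair i k) % p

/-- A bound for the number of digits of an array. -/
def digitBound (n r : ℕ) : ℕ := Nat.pair (n + 1) (Nat.pair (4 * (n * r) + 3) n)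

/-- The entries of a list of matrices. -/
def listEntry (M : List (List (List ℕ))) (z k j : ℕ) : ℕ :=
  ((M.getD z []).getD k []).getD j 0

/-- The finite check deciding positive expansivity modulo a prime. -/
def FiniteCheck (n r p : ℕ) (M : List (List (List ℕ))) : Prop :=
  ∀ x < p ^ digitBound n r, Evolves n r p (listEntry M) (digitArray p x) →
    VanishesOnWindow n r (digitArray p x) → VanishesOnBorder n r (digitArray p x)

theorem exists_digits {p : ℕ} (hp : 0 < p) (B : ℕ) (u : ℕ → ℕ) (hu : ∀ d, u d < p) :
    ∃ x < p ^ B, ∀ d < B, x / p ^ d % p = u d := by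
  induction B generalizing u with
  | zero => exact ⟨0, by simp, by simp⟩
  | succ B ih =>
    obtain ⟨x, hx, h⟩ := ih (fun d => u (d + 1)) fun d => hu _
    refine ⟨u 0 + p * x, ?_, fun d hd => ?_⟩
    · have := Nat.mul_le_mul_left p (Nat.succ_le_of_lt hx)
      have h0 := hu 0
      rw [pow_succ', Nat.mul_succ] at *
      omega
    · cases d with
      | zero => simp [Nat.mod_eq_of_lt (hu 0)]
      | succ d =>
        rw [pow_succ', ← Nat.div_div_eq_div_mul, Nat.add_mul_div_left _ _ hp,
          Nat.div_eq_of_lt (hu 0), zero_add]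
        exact h d (by omega)

/-- `Nat.pair` is strictly increasing in each argument, so all cells of the array have index below
`digitBound n r`. -/
theorem exists_digitArray {p : ℕ} (hp : 0 < p) (n r : ℕ) (u : ℕ → ℕ → ℕ → ℕ)
    (hu : ∀ l i k, u l i k < p) : ∃ x < p ^ digitBound n r,
      ∀ l < n + 1, ∀ i < 4 * (n * r) + 3, ∀ k < n, digitArray p x l i k = u l i k := by
  obtain ⟨x, hx, h⟩ := exists_digits hp (digitBound n r)
    (fun d => u d.unpair.1 d.unpair.2.unpair.1 d.unpair.2.unpair.2) fun d => hu _ _ _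
  refine ⟨x, hx, fun l hl i hi k hk => ?_⟩
  rw [digitArray, h]
  · simp
  · exact (Nat.pair_lt_pair_left _ hl).trans (Nat.pair_lt_pair_right _
      ((Nat.pair_lt_pair_left _ hi).trans (Nat.pair_lt_pair_right _ hk)))

theorem getD_ofFn {α : Type*} {n : ℕ} (f : Fin n → α) (i : Fin n) (d : α) :
    (List.ofFn f).getD i d = f i := by
  rw [List.getD_eq_getElem _ _ (by simp), List.getElem_ofFn]

end SpaceTime

namespace LinearRule

variable {m n : ℕ} (A : LinearRule m n)

theorem listEntry_code (z : Fin (2 * A.radius + 1)) (k j : Fin n) :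
    listEntry A.code.2.2.2 z k j = (A.mat z k j).val := by
  simp only [listEntry, code, getD_ofFn]

theorem reduce_step [NeZero m] {p : ℕ} (h : p ∣ m) (c : ℤ → Fin n → ZMod p) (u : ℕ → ℕ → ℕ)
    (i : ℕ) (y : ℤ) (hc : ∀ z : Fin (2 * A.radius + 1), ∀ j : Fin n,
      c (y + ((z : ℤ) - A.radius)) j = (u (i + z) j : ZMod p)) (k : Fin n) :
    (A.reduce h).automatonHom c y k = ((∑ z ∈ Finset.range (2 * A.radius + 1),
      ∑ j ∈ Finset.range n, listEntry A.code.2.2.2 z k j * u (i + z) j : ℕ) : ZMod p) := by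
  rw [automatonHom_apply, automaton_apply, Finset.sum_apply, Nat.cast_sum, Finset.sum_range]
  refine Finset.sum_congr rfl fun z _ => ?_
  rw [Nat.cast_sum, Finset.sum_range, Matrix.mulVec, dotProduct]
  refine Finset.sum_congr rfl fun j _ => ?_
  rw [Nat.cast_mul, A.listEntry_code z k j, ZMod.natCast_val, ← hc z j]
  rfl

/-- With `N = n * r`, index `i` stands for cell `i - (2 * N + 1)`: the window is `N + 1, …, 3 * N +
1` and its neighbours are `N` and `3 * N + 2`. A margin of `N` further cells on each side suffices,
since information travels at most `r` cells per step for `n` steps. -/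
theorem windowGrows_reduce_iff_finiteCheck [NeZero m] {p : ℕ} [Fact p.Prime] (h : p ∣ m)
    (hn : 1 ≤ n) : (A.reduce h).WindowGrows (n * A.radius) n ↔
      FiniteCheck n A.radius p A.code.2.2.2 := by
  have hp : 0 < p := (Fact.out : p.Prime).pos
  have hrl : ∀ l ≤ n, l * A.radius ≤ n * A.radius := fun l hl => Nat.mul_le_mul_right _ hl
  have hr := hrl 1 hn
  rw [one_mul] at hr
  constructor
  · intro hW x _ hev hwin
    set u := digitArray p x
    have hult : ∀ l i k, u l i k < p := fun l i k => Nat.mod_lt _ hp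
    unfold Evolves at hev
    unfold VanishesOnWindow at hwin
    unfold VanishesOnBorder
    generalize hN : n * A.radius = N at *
    -- The values of `c` outside the array are immaterial: `horb` compares orbits only where they
    -- depend on the array alone.
    let c : ℤ → Fin n → ZMod p := fun y k => (u 0 (y + (2 * N + 1)).toNat k : ZMod p)
    have horb : ∀ l ≤ n, ∀ i : ℕ, l * A.radius ≤ i → i + l * A.radius < 4 * N + 3 →
        ∀ (y : ℤ), y + (2 * N + 1) = i → ∀ k : Fin n,
        ((A.reduce h).automatonHom ^ l) c y k = (u l i k : ZMod p) := by
      intro l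
      induction l with
      | zero =>
        intro _ i _ _ y hy k
        simp only [pow_zero, Module.End.one_apply, c, hy, Int.toNat_natCast]
      | succ l ih =>
        intro hl i h1 h2 y hy k
        rw [add_mul, one_mul] at h1 h2
        obtain ⟨i, rfl⟩ := Nat.exists_eq_add_of_le' (show A.radius ≤ i by omega)
        rw [hev l (by omega) i (by omega) k k.2, pow_succ', Module.End.mul_apply,
          A.reduce_step h _ (u l) i y, ZMod.natCast_mod]
        intro z j
        have hz := z.2
        exact ih (by omega) _ (by omega) (by omega) _ (by push_cast at hy ⊢; omega) j
    obtain ⟨hpos, hneg⟩ := hW c fun l hl j hj => by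
      funext k
      have := hrl l hl
      rw [horb l hl (j + (2 * N + 1)).toNat (by omega) (by omega) j (by omega) k]
      have hz := hwin l (by omega) (j + N).toNat (by omega) k k.2
      rw [show (j + N).toNat + (N + 1) = (j + (2 * N + 1)).toNat by omega] at hz
      rw [hz]
      simp
    intro k hk
    have hcast : ∀ i, (u 0 i k : ZMod p) = 0 → u 0 i k = 0 := fun i hi =>
      Nat.eq_zero_of_dvd_of_lt ((ZMod.natCast_eq_zero_iff _ _).1 hi) (hult _ _ _)
    refine ⟨hcast _ ?_, hcast _ ?_⟩
    · have := congrFun hpos ⟨k, hk⟩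
      simp only [c] at this
      rwa [show ((N : ℤ) + 1 + (2 * N + 1)).toNat = 3 * N + 2 by omega] at this
    · have := congrFun hneg ⟨k, hk⟩
      simp only [c] at this
      rwa [show (-((N : ℤ) + 1) + (2 * N + 1)).toNat = N by omega] at this
  · intro hF c hc
    let v : ℕ → ℕ → ℕ → ℕ := fun l i k => if hk : k < n then
      (((A.reduce h).automatonHom ^ l) c ((i : ℤ) - (2 * (n * A.radius : ℕ) + 1)) ⟨k, hk⟩).val
      else 0
    have hv : ∀ l i (k : Fin n), v l i k =
        (((A.reduce h).automatonHom ^ l) c ((i : ℤ) - (2 * (n * A.radius : ℕ) + 1)) k).val := by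
      intro l i k
      simp only [v, k.2, dif_pos]
    obtain ⟨x, hx, hxv⟩ := exists_digitArray hp n A.radius v fun l i k => by
      simp only [v]
      split_ifs
      exacts [ZMod.val_lt _, hp]
    have hF := hF x hx
    unfold Evolves VanishesOnWindow VanishesOnBorder at hF
    generalize n * A.radius = N at *
    have hB := hF ?_ ?_
    · have hz : ∀ i < 4 * N + 3, (∀ k < n, digitArray p x 0 i k = 0) →
          c ((i : ℤ) - (2 * N + 1)) = 0 := by
        intro i hi hk
        funext k
        have := hk k k.2
        rw [hxv 0 (by omega) i hi k k.2, hv, ZMod.val_eq_zero] at this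
        exact this
      refine ⟨?_, ?_⟩
      · have := hz (3 * N + 2) (by omega) fun k hk => (hB k hk).1
        rwa [show ((3 * N + 2 : ℕ) : ℤ) - (2 * N + 1) = N + 1 by push_cast; ring] at this
      · have := hz N (by omega) fun k hk => (hB k hk).2
        rwa [show (N : ℤ) - (2 * N + 1) = -(N + 1) by ring] at this
    · intro l hl i hi k hk
      rw [hxv (l + 1) (by omega) (i + A.radius) (by omega) k hk, hv _ _ ⟨k, hk⟩, pow_succ',
        Module.End.mul_apply, A.reduce_step h _ (digitArray p x l) i, ZMod.val_natCast]
      intro z j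
      have hz := z.2
      rw [hxv l (by omega) (i + z) (by omega) j j.2, hv, ZMod.natCast_val, ZMod.cast_id]
      exact congrArg (fun y => ((A.reduce h).automatonHom ^ l) c y j) (by push_cast; ring)
    · intro l hl i hi k hk
      rw [hxv l hl _ (by omega) k hk, hv _ _ ⟨k, hk⟩, hc l (by omega) _ (by omega)]
      simp

end LinearRule

end LinearCA

namespace LinearCA

/-! ### Primitive recursiveness of the check -/

section Primrec

variable {α : Type*} [Primcodable α]

theorem primrecPred_forall_lt {R : α → ℕ → Prop} {f : α → ℕ} (hf : Primrec f)
    (hR : PrimrecPred fun q : α × ℕ => R q.1 q.2) : PrimrecPred fun a => ∀ x < f a, R a x := by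
  have h : PrimrecRel fun (x : ℕ) (a : α) => R a x := hR.comp (Primrec.pair .snd .fst)
  exact (h.forall_mem_list.comp (Primrec.list_range.comp hf) .id).of_eq fun a => by simp

theorem primrecPred_imp {P Q : α → Prop} (hP : PrimrecPred P) (hQ : PrimrecPred Q) :
    PrimrecPred fun a => P a → Q a :=
  (hP.not.or hQ).of_eq fun _ => imp_iff_not_or.symm

theorem primrec_sum_range {f : α → ℕ → ℕ} {g : α → ℕ} (hg : Primrec g)
    (hf : Primrec fun q : α × ℕ => f q.1 q.2) :
    Primrec fun a => ∑ i ∈ Finset.range (g a), f a i := by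
  have hstep : Primrec₂ fun (a : α) (q : ℕ × ℕ) => q.2 + f a q.1 :=
    Primrec.nat_add.comp (Primrec.snd.comp .snd)
      (hf.comp (Primrec.pair .fst (Primrec.fst.comp .snd)))
  refine (Primrec.nat_rec' hg (Primrec.const 0) hstep).of_eq fun a => ?_
  induction g a with
  | zero => rfl
  | succ k ih => rw [Finset.sum_range_succ, ← ih]

theorem primrec_nat_pow : Primrec₂ ((· ^ ·) : ℕ → ℕ → ℕ) :=
  Primrec₂.unpaired'.1 Nat.Primrec.pow

theorem primrecPred_dvd {f g : α → ℕ} (hf : Primrec f) (hg : Primrec g) :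
    PrimrecPred fun a => f a ∣ g a :=
  (Primrec.eq.comp (Primrec.nat_mod.comp hg hf) (Primrec.const 0)).of_eq fun _ =>
    (Nat.dvd_iff_mod_eq_zero).symm

theorem primrecPred_prime {f : α → ℕ} (hf : Primrec f) : PrimrecPred fun a => (f a).Prime := by
  have h : PrimrecPred fun a => 2 ≤ f a ∧ ∀ x < f a, x ∣ f a → x = 1 :=
    (Primrec.nat_le.comp (Primrec.const 2) hf).and (primrecPred_forall_lt hf
      (primrecPred_imp (primrecPred_dvd .snd (hf.comp .fst))
        (Primrec.eq.comp .snd (Primrec.const 1))))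
  exact h.of_eq fun a => Nat.prime_def_lt.symm

theorem primrec_digitArray {p x l i k : α → ℕ} (hp : Primrec p) (hx : Primrec x) (hl : Primrec l)
    (hi : Primrec i) (hk : Primrec k) :
    Primrec fun a => digitArray (p a) (x a) (l a) (i a) (k a) :=
  Primrec.nat_mod.comp (Primrec.nat_div.comp hx (primrec_nat_pow.comp hp
    (Primrec₂.natPair.comp hl (Primrec₂.natPair.comp hi hk)))) hp

theorem primrec_listEntry {M : α → List (List (List ℕ))} {z k j : α → ℕ} (hM : Primrec M)
    (hz : Primrec z) (hk : Primrec k) (hj : Primrec j) :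
    Primrec fun a => listEntry (M a) (z a) (k a) (j a) :=
  (Primrec.list_getD 0).comp ((Primrec.list_getD []).comp
    ((Primrec.list_getD []).comp hM hz) hk) hj

section Checks

variable {n r p x : α → ℕ}

theorem primrecPred_evolves {M : α → List (List (List ℕ))} (hM : Primrec M) (hn : Primrec n)
    (hr : Primrec r) (hp : Primrec p) (hx : Primrec x) : PrimrecPred fun a =>
      Evolves (n a) (r a) (p a) (listEntry (M a)) (digitArray (p a) (x a)) := by
  have hwidth : Primrec fun a => 4 * (n a * r a) + 3 - 2 * r a :=
    Primrec.nat_sub.comp (Primrec.nat_add.comp (Primrec.nat_mul.comp (Primrec.const 4)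
      (Primrec.nat_mul.comp hn hr)) (Primrec.const 3)) (Primrec.nat_mul.comp (Primrec.const 2) hr)
  have hrange : Primrec fun a => 2 * r a + 1 :=
    Primrec.nat_add.comp (Primrec.nat_mul.comp (Primrec.const 2) hr) (Primrec.const 1)
  refine primrecPred_forall_lt hn (primrecPred_forall_lt (hwidth.comp .fst)
    (primrecPred_forall_lt (hn.comp (Primrec.fst.comp .fst)) ?_))
  have h₀ : Primrec fun q : ((α × ℕ) × ℕ) × ℕ => q.1.1.1 :=
    Primrec.fst.comp (Primrec.fst.comp .fst)
  have hl : Primrec fun q : ((α × ℕ) × ℕ) × ℕ => q.1.1.2 :=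
    Primrec.snd.comp (Primrec.fst.comp .fst)
  have hi : Primrec fun q : ((α × ℕ) × ℕ) × ℕ => q.1.2 := Primrec.snd.comp .fst
  have hk : Primrec fun q : ((α × ℕ) × ℕ) × ℕ => q.2 := Primrec.snd
  refine Primrec.eq.comp (primrec_digitArray (hp.comp h₀) (hx.comp h₀) (Primrec.succ.comp hl)
    (Primrec.nat_add.comp hi (hr.comp h₀)) hk) (Primrec.nat_mod.comp (primrec_sum_range
      (hrange.comp h₀) (primrec_sum_range (hn.comp (h₀.comp .fst)) ?_)) (hp.comp h₀))
  have h₁ : Primrec fun s : ((((α × ℕ) × ℕ) × ℕ) × ℕ) × ℕ => s.1.1 := Primrec.fst.comp .fst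
  have hz : Primrec fun s : ((((α × ℕ) × ℕ) × ℕ) × ℕ) × ℕ => s.1.2 := Primrec.snd.comp .fst
  have hj : Primrec fun s : ((((α × ℕ) × ℕ) × ℕ) × ℕ) × ℕ => s.2 := Primrec.snd
  exact Primrec.nat_mul.comp
    (primrec_listEntry (hM.comp (h₀.comp h₁)) hz (hk.comp h₁) hj)
    (primrec_digitArray (hp.comp (h₀.comp h₁)) (hx.comp (h₀.comp h₁)) (hl.comp h₁)
      (Primrec.nat_add.comp (hi.comp h₁) hz) hj)

theorem primrecPred_vanishesOnWindow (hn : Primrec n) (hr : Primrec r) (hp : Primrec p)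
    (hx : Primrec x) :
    PrimrecPred fun a => VanishesOnWindow (n a) (r a) (digitArray (p a) (x a)) := by
  have hN : Primrec fun a => n a * r a := Primrec.nat_mul.comp hn hr
  have hwidth : Primrec fun a => 2 * (n a * r a) + 1 :=
    Primrec.succ.comp (Primrec.nat_mul.comp (Primrec.const 2) hN)
  refine primrecPred_forall_lt (Primrec.succ.comp hn) (primrecPred_forall_lt (hwidth.comp .fst)
    (primrecPred_forall_lt (hn.comp (Primrec.fst.comp .fst)) ?_))
  have h₀ : Primrec fun q : ((α × ℕ) × ℕ) × ℕ => q.1.1.1 :=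
    Primrec.fst.comp (Primrec.fst.comp .fst)
  exact Primrec.eq.comp (primrec_digitArray (hp.comp h₀) (hx.comp h₀)
    (Primrec.snd.comp (Primrec.fst.comp .fst))
    (Primrec.nat_add.comp (Primrec.snd.comp .fst) (Primrec.succ.comp (hN.comp h₀))) .snd)
    (Primrec.const 0)

theorem primrecPred_vanishesOnBorder (hn : Primrec n) (hr : Primrec r) (hp : Primrec p)
    (hx : Primrec x) :
    PrimrecPred fun a => VanishesOnBorder (n a) (r a) (digitArray (p a) (x a)) := by
  have hN : Primrec fun a => n a * r a := Primrec.nat_mul.comp hn hr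
  have hright : Primrec fun a => 3 * (n a * r a) + 2 :=
    Primrec.nat_add.comp (Primrec.nat_mul.comp (Primrec.const 3) hN) (Primrec.const 2)
  have hdigit : ∀ {f : α → ℕ}, Primrec f → PrimrecPred fun q : α × ℕ =>
      digitArray (p q.1) (x q.1) 0 (f q.1) q.2 = 0 := fun hf =>
    Primrec.eq.comp (primrec_digitArray (hp.comp .fst) (hx.comp .fst) (Primrec.const 0)
      (hf.comp .fst) .snd) (Primrec.const 0)
  exact primrecPred_forall_lt hn ((hdigit hright).and (hdigit hN))

/-- Encoding arrays as base `p` numbers makes the quantifier over arrays a bounded quantifier over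
`ℕ`. -/
theorem primrecPred_finiteCheck {M : α → List (List (List ℕ))} (hM : Primrec M) (hn : Primrec n)
    (hr : Primrec r) (hp : Primrec p) : PrimrecPred fun a => FiniteCheck (n a) (r a) (p a) (M a) := by
  have hbound : Primrec fun a => p a ^ digitBound (n a) (r a) :=
    primrec_nat_pow.comp hp (Primrec₂.natPair.comp (Primrec.succ.comp hn) (Primrec₂.natPair.comp
      (Primrec.nat_add.comp (Primrec.nat_mul.comp (Primrec.const 4) (Primrec.nat_mul.comp hn hr))
        (Primrec.const 3)) hn))
  exact primrecPred_forall_lt hbound (primrecPred_imp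
    (primrecPred_evolves (hM.comp .fst) (hn.comp .fst) (hr.comp .fst) (hp.comp .fst) .snd)
    (primrecPred_imp
      (primrecPred_vanishesOnWindow (hn.comp .fst) (hr.comp .fst) (hp.comp .fst) .snd)
      (primrecPred_vanishesOnBorder (hn.comp .fst) (hr.comp .fst) (hp.comp .fst) .snd)))

end Checks

/-- The condition on the finite description of a linear cellular automaton that is equivalent to
its positive expansivity. -/
def CodeCheck (q : ℕ × ℕ × ℕ × List (List (List ℕ))) : Prop :=
  ∀ p < q.1 + 1, p.Prime → p ∣ q.1 → FiniteCheck q.2.1 q.2.2.1 p q.2.2.2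

theorem primrecPred_codeCheck : PrimrecPred CodeCheck :=
  primrecPred_forall_lt (Primrec.succ.comp .fst) (primrecPred_imp (primrecPred_prime .snd)
    (primrecPred_imp (primrecPred_dvd .snd (Primrec.fst.comp .fst))
      (primrecPred_finiteCheck
        (Primrec.snd.comp (Primrec.snd.comp (Primrec.snd.comp .fst)))
        (Primrec.fst.comp (Primrec.snd.comp .fst))
        (Primrec.fst.comp (Primrec.snd.comp (Primrec.snd.comp .fst))) .snd)))

end Primrec

theorem LinearRule.codeCheck_iff {m n : ℕ} (hm : 1 < m) (hn : 1 ≤ n) (A : LinearRule m n) :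
    CodeCheck A.code ↔ PositivelyExpansive A.automaton := by
  have : NeZero m := ⟨by omega⟩
  rw [A.positivelyExpansive_iff_forall_prime (NeZero.ne m)]
  have key : ∀ (p : ℕ) (_ : p.Prime) (h : p ∣ m), FiniteCheck n A.radius p A.code.2.2.2 ↔
      PositivelyExpansive (A.reduce h).automaton := by
    intro p hp h
    have : Fact p.Prime := ⟨hp⟩
    rw [(A.reduce h).positivelyExpansive_iff_windowGrows hn]
    exact (A.windowGrows_reduce_iff_finiteCheck h hn).symm
  constructor
  · exact fun H p hp h => (key p hp h).1
      (H p (Nat.lt_succ_of_le (show p ≤ m from Nat.le_of_dvd (by omega) h)) hp h)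
  · exact fun H p _ hp h => (key p hp h).2 (H p hp h)

end LinearCA

theorem mainTheorem5 :
    (∀ (m n : ℕ), 1 < m → 1 ≤ n → ∀ A : LinearCA.LinearRule m n,
      (LinearCA.PositivelyExpansive A.automaton ↔
        ∀ (p : ℕ) (_ : p.Prime) (h : p ∣ m),
          LinearCA.ExpansiveMatrix (LinearCA.reduceMod h A.assocMatrix))) ∧
    ∃ D : ℕ × ℕ × ℕ × List (List (List ℕ)) → Bool, Computable D ∧
      ∀ (m n : ℕ), 1 < m → 1 ≤ n → ∀ A : LinearCA.LinearRule m n,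
        (D A.code = true ↔ LinearCA.PositivelyExpansive A.automaton) := by
  refine ⟨fun m n hm hn A => A.positivelyExpansive_iff_forall_expansiveMatrix hm hn, ?_⟩
  obtain ⟨_, hD⟩ := LinearCA.primrecPred_codeCheck
  exact ⟨_, hD.to_comp, fun m n hm hn A => decide_eq_true_iff.trans (A.codeCheck_iff hm hn)⟩
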